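/- Let $\mathsf X$ be a finite set. A finite word $w=x_n\dots x_2x_1$ over $\mathsf X$ is read from the left; $\mathsf X^*$ is the rooted tree of finite words, in which $w$ is joined to $wx$ for $x\in\mathsf X$. Let $\mathsf X^{-\omega}$ be the space of left-infinite words $\dots x_2x_1$, with the product topology of the discrete set $\mathsf X$, let $\sigma(\dots x_2x_1)=\dots x_3x_2$, and for $i\in\mathsf X$ write $i(\dots x_2x_1)=\dots x_2x_1i$. *Self-similar structures.* A self-similar structure $\mathcal L=(K,\mathsf X,\{F_i\}_{i\in\mathsf X})$ consists of a compact metrizable space $K$ and continuous injections $F_i:K\to K$ for which there is a (necessarily unique) continuous surjection $\pi:\mathsf X^{-\omega}\to K$ with $F_i\circ\pi=\pi\circ i$ for all $i$. It is p.c.f. if $\bigcup_{n\ge1}\sigma^n(\mathcal C)$ is finite, where $\mathcal C=\pi^{-1}\big(\bigcup_{i\ne j}F_i(K)\cap F_j(K)\big)$. Structures $(K_1,\mathsf X_1,\cdot)$ and $(K_2,\mathsf X_2,\cdot)$ with surjections $\pi_1,\pi_2$ are isomorphic if there is a bijection $\rho:\mathsf X_1\to\mathsf X_2$ such that $\pi_2\circ\iota_\rho\circ\pi_1^{-1}$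 is a well-defined homeomorphism $K_1\to K_2$, where $\iota_\rho(\dots x_2x_1)=\dots\rho(x_2)\rho(x_1)$. *Contracting actions.* A contracting action $(G,\mathsf X)$ is a faithful action of a group $G$ on the rooted tree $\mathsf X^*$ by automorphisms such that (a) for all $g\in G$, $x\in\mathsf X$ there are $h\in G$, $y\in\mathsf X$ with $g(xw)=y\,h(w)$ for all $w\in\mathsf X^*$, so that for every $v\in\mathsf X^*$ there is a unique $g|_v\in G$ with $g(vw)=g(v)\,g|_v(w)$ for all $w$; and (b) there is a finite set $\mathcal N\subset G$ such that for every $g\in G$ there is $k$ with $g|_v\in\mathcal N$ whenever $|v|\ge k$. Its limit space $\mathcal J_G$ is the quotient space of $\mathsf X^{-\omega}$ by the relation under which $\dots x_2x_1$ and $\dots y_2y_1$ are equivalent if there is a sequence $(g_k)_{k\ge1}$ in $G$, taking only finitely many values, with $g_k(x_k\dots x_1)=y_k\dots y_1$ for all $k\ge1$; let $p:\mathsf X^{-\omega}\to\mathcal J_G$ be the quotient map. A self-similar structure on the limit space $\mathcal J_G$ means one whose surjection is $p$. **Theorem.** Let $\mathcal L=(K,\mathsf X,\{F_i\}_{i\in\mathsf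 X})$ be a p.c.f. self-similar structure with associated surjection $\pi:\mathsf X^{-\omega}\to K$. There exists a contracting action $(G,\mathsf X)$ whose limit space $\mathcal J_G$ has a self-similar structure $\mathcal L'=(\mathcal J_G,\mathsf X,\{F'_i\}_{i\in\mathsf X})$ isomorphic to $\mathcal L$ if and only if the induced shift map $\mathsf s:K\to K$ is well defined, i.e. there is a map $\mathsf s:K\to K$ with $\mathsf s\circ\pi=\pi\circ\sigma$. -/

import Mathlib

universe u v w

namespace SelfSimilar

/-! ### Words

A finite word `x_n … x_2 x_1` is the list `[x_n, …, x_2, x_1]`, so that the head of the list is the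
leftmost letter. A left-infinite word `… x_3 x_2 x_1` is the sequence `ℕ → X` whose value at `n` is
the letter `x_{n+1}`; it carries the product topology of the discrete alphabet. -/

/-- The shift `σ (… x_3 x_2 x_1) = … x_3 x_2`. -/
def shift {X : Type u} (x : ℕ → X) : ℕ → X := fun n => x (n + 1)

/-- The map `… x_2 x_1 ↦ … x_2 x_1 i`. -/
def appendLetter {X : Type u} (i : X) (x : ℕ → X) : ℕ → X
  | 0 => i
  | n + 1 => x n

/-- The finite word `x_k … x_2 x_1` cut out of `… x_2 x_1`. -/
def trunc {X : Type u} (x : ℕ → X) : ℕ → List X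
  | 0 => []
  | k + 1 => x k :: trunc x k

/-- The rooted tree of finite words: `w` is joined by an edge to each `w x` with `x` a letter, so
that the words beginning with `v` form the subtree rooted at `v`. -/
def wordTree (X : Type u) : SimpleGraph (List X) :=
  SimpleGraph.fromRel fun a b => ∃ x : X, b = a ++ [x]

/-! ### Self-similar and contracting actions -/

section Actions

variable (G : Type v) (X : Type u) [Group G] [MulAction G (List X)]

/-- A faithful action of `G` on the rooted tree of words by automorphisms which is self-similar:
for all `g` and `x` there are `h` and `y` with `g (x w) = y h(w)` for every word `w`. -/
structure IsSelfSimilarAction : Prop where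
  smul_nil : ∀ g : G, g • ([] : List X) = []
  adj_iff : ∀ (g : G) (a b : List X), (wordTree X).Adj (g • a) (g • b) ↔ (wordTree X).Adj a b
  faithful : ∀ g h : G, (∀ a : List X, g • a = h • a) → g = h
  stateClosed : ∀ (g : G) (x : X), ∃ (h : G) (y : X), ∀ a : List X, g • (x :: a) = y :: (h • a)

variable {G X} in
/-- `h` is the restriction `g|_a`, that is, `g (a b) = g(a) h(b)` for every word `b`. -/
def IsRestriction (g : G) (a : List X) (h : G) : Prop :=
  ∀ b : List X, g • (a ++ b) = (g • a) ++ (h • b)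

/-- A self-similar action is contracting if there is a finite set `N ⊆ G` such that for every `g`
there is a `k` with `g|_a ∈ N` for all words `a` of length at least `k`. -/
structure IsContractingAction : Prop where
  isSelfSimilarAction : IsSelfSimilarAction G X
  exists_finite : ∃ N : Set G, N.Finite ∧
    ∀ g : G, ∃ k : ℕ, ∀ a : List X, k ≤ a.length → ∃ h ∈ N, IsRestriction g a h

variable {X} in
/-- Asymptotic equivalence of left-infinite words: there is a sequence `g_k`, taking finitely many
values, with `g_k (x_k … x_1) = y_k … y_1` for every `k ≥ 1`. -/
def AsymptoticallyEquivalent (x y : ℕ → X) : Prop :=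
  ∃ g : ℕ → G, (Set.range g).Finite ∧ ∀ k : ℕ, 1 ≤ k → g k • trunc x k = trunc y k

theorem AsymptoticallyEquivalent.refl (x : ℕ → X) : AsymptoticallyEquivalent G x x :=
  ⟨fun _ => 1, Set.finite_range_const, fun _ _ => one_smul _ _⟩

variable {G X} in
theorem AsymptoticallyEquivalent.symm {x y : ℕ → X} (h : AsymptoticallyEquivalent G x y) :
    AsymptoticallyEquivalent G y x := by
  obtain ⟨g, hg, hxy⟩ := h
  refine ⟨fun k => (g k)⁻¹, ?_, fun k hk => ?_⟩
  · refine (hg.image fun a => a⁻¹).subset ?_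
    rintro _ ⟨k, rfl⟩
    exact ⟨g k, ⟨k, rfl⟩, rfl⟩
  · rw [← hxy k hk, inv_smul_smul]

variable {G X} in
theorem AsymptoticallyEquivalent.trans {x y z : ℕ → X} (h : AsymptoticallyEquivalent G x y)
    (h' : AsymptoticallyEquivalent G y z) : AsymptoticallyEquivalent G x z := by
  obtain ⟨g, hg, hxy⟩ := h
  obtain ⟨g', hg', hyz⟩ := h'
  refine ⟨fun k => g' k * g k, ?_, fun k hk => ?_⟩
  · refine (hg'.image2 (fun a b => a * b) hg).subset ?_
    rintro _ ⟨k, rfl⟩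
    exact ⟨g' k, ⟨k, rfl⟩, g k, ⟨k, rfl⟩, rfl⟩
  · rw [mul_smul, hxy k hk, hyz k hk]

/-- Asymptotic equivalence as an equivalence relation. -/
def asymptoticSetoid : Setoid (ℕ → X) where
  r := AsymptoticallyEquivalent G
  iseqv := ⟨AsymptoticallyEquivalent.refl G X, AsymptoticallyEquivalent.symm,
    AsymptoticallyEquivalent.trans⟩

/-- The limit space: left-infinite words modulo asymptotic equivalence, with the quotient
topology. -/
abbrev LimitSpace : Type u := Quotient (asymptoticSetoid G X)

/-- The quotient map `p` onto the limit space. -/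
def limitMap : (ℕ → X) → LimitSpace G X := Quotient.mk (asymptoticSetoid G X)

end Actions

/-! ### Self-similar structures -/

/-- A self-similar structure on the compact metrizable space `K` over the finite discrete alphabet
`X`: continuous injections `F i`, for which there is a continuous surjection `π` from the
left-infinite words with `F i ∘ π = π ∘ i`. Such a `π` is determined by the maps `F i`; it is
carried along as the associated surjection. -/
structure SelfSimilarStructure (X : Type u) (K : Type v) [TopologicalSpace X]
    [TopologicalSpace K] where
  compactSpace : CompactSpace K
  metrizableSpace : TopologicalSpace.MetrizableSpace K
  F : X → K → K
  continuous_F : ∀ i, Continuous (F i)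
  injective_F : ∀ i, Function.Injective (F i)
  π : (ℕ → X) → K
  continuous_π : Continuous π
  surjective_π : Function.Surjective π
  F_comp_π : ∀ i, F i ∘ π = π ∘ appendLetter i

namespace SelfSimilarStructure

section

variable {X : Type u} {K : Type v} [TopologicalSpace X] [TopologicalSpace K]

/-- The critical set `π⁻¹ (⋃_{i ≠ j} K_i ∩ K_j)`, where `K_i = F_i (K)`. -/
def criticalSet (L : SelfSimilarStructure X K) : Set (ℕ → X) :=
  L.π ⁻¹' ⋃ (i : X) (j : X) (_ : i ≠ j), Set.range (L.F i) ∩ Set.range (L.F j)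

/-- The post-critical set `⋃_{n ≥ 1} σⁿ (C)`, where `C` is the critical set. -/
def postCriticalSet (L : SelfSimilarStructure X K) : Set (ℕ → X) :=
  ⋃ (n : ℕ) (_ : 1 ≤ n), shift^[n] '' L.criticalSet

/-- Post-critical finiteness. -/
def IsPCF (L : SelfSimilarStructure X K) : Prop := L.postCriticalSet.Finite

end

/-- Isomorphism of self-similar structures: for some bijection `ρ` of the alphabets, with induced
map `ι` on left-infinite words, `π₂ ∘ ι ∘ π₁⁻¹` is a well-defined homeomorphism `K₁ → K₂`. -/
def Isomorphic {X₁ X₂ : Type u} {K₁ : Type v} {K₂ : Type w} [TopologicalSpace X₁]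
    [TopologicalSpace X₂] [TopologicalSpace K₁] [TopologicalSpace K₂]
    (L₁ : SelfSimilarStructure X₁ K₁) (L₂ : SelfSimilarStructure X₂ K₂) : Prop :=
  ∃ (ρ : X₁ ≃ X₂) (h : K₁ ≃ₜ K₂), ∀ x : ℕ → X₁, h (L₁.π x) = L₂.π (fun n => ρ (x n))

/-- The induced shift map `s : K → K`, given by `s ∘ π = π ∘ σ`, is well defined. -/
def ShiftWellDefined {X : Type u} {K : Type v} [TopologicalSpace X] [TopologicalSpace K]
    (L : SelfSimilarStructure X K) : Prop :=
  ∃ s : K → K, s ∘ L.π = L.π ∘ shift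

end SelfSimilarStructure

end SelfSimilar

/-! Tree automorphisms respect prefixes, so asymptotic equivalence survives deleting the last
letter; hence the shift descends to every limit space and to any isomorphic structure.

Conversely, given `s`, the group is built to identify exactly the words with equal `π`. A family of
permutations `τ_c` that never changes `F_i(c)` yields tree automorphisms `g_c` with restrictions
`g_c|_v = g_{F_v(c)}` and `F_{g_c(v)}(c) = F_v(c)`. Off the finite set `P` of post-critical points
`τ_c` is trivial, and `s` shows that `c ∉ P` implies `F_i(c) ∉ P`; so `g_c = 1` there and only
finitely many generators occur.

Each group element moves the cells of long words very little, and its restrictions there are trivial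
or some `g_a` with `a ∈ P` near the cell. Points of `P` are separated, so two factors of a product
meet at the same `a` and multiply to another `g_a` (`exists_isCloseAt`). This gives contraction, and
equality of `π` on asymptotic classes. If `π x = π y`, a single family `τ` carries each letter of
`x` to that of `y` along the orbit of `π x` (`exists_permGroup_apply_eq`); its consistency rests on
`apply_zero_eq_of_periodic`. -/

namespace SelfSimilar

/-! ### Finite and left-infinite words -/

section Words

variable {X : Type u}

theorem shift_appendLetter (i : X) (x : ℕ → X) : shift (appendLetter i x) = x := rfl

theorem appendLetter_shift (x : ℕ → X) : appendLetter (x 0) (shift x) = x := by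
  funext n; cases n <;> rfl

theorem shift_iterate_apply (x : ℕ → X) (n k : ℕ) : shift^[n] x k = x (k + n) := by
  induction n generalizing x with
  | zero => rfl
  | succ n ih => rw [Function.iterate_succ_apply, ih]; exact congrArg x (by omega)

theorem length_trunc (x : ℕ → X) (k : ℕ) : (trunc x k).length = k := by
  induction k with
  | zero => rfl
  | succ k ih => simp [trunc, ih]

theorem trunc_succ_eq_append (x : ℕ → X) (k : ℕ) :
    trunc x (k + 1) = trunc (shift x) k ++ [x 0] := by
  induction k with
  | zero => rfl
  | succ k ih => rw [trunc, ih]; rfl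

/-- The left-infinite word `x v` obtained by writing the finite word `v` to the right of `x`. -/
def appendWord (v : List X) (x : ℕ → X) : ℕ → X := v.foldl (fun y i => appendLetter i y) x

theorem appendWord_append_singleton (v : List X) (i : X) (x : ℕ → X) :
    appendWord (v ++ [i]) x = appendLetter i (appendWord v x) := by
  simp [appendWord]

theorem appendWord_apply_eq (v : List X) (x y : ℕ → X) {n : ℕ} (hn : n < v.length) :
    appendWord v x n = appendWord v y n := by
  induction v using List.reverseRecOn generalizing n with
  | nil => simp at hn
  | append_singleton v i ih =>
    simp only [appendWord_append_singleton]
    cases n with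
    | zero => rfl
    | succ n => exact ih (by simpa using hn)

theorem appendWord_trunc (x : ℕ → X) (k : ℕ) : appendWord (trunc x k) (shift^[k] x) = x := by
  induction k generalizing x with
  | zero => rfl
  | succ k ih =>
    rw [trunc_succ_eq_append, appendWord_append_singleton, Function.iterate_succ_apply, ih,
      appendLetter_shift]

theorem shift_iterate_appendWord (v : List X) (x : ℕ → X) :
    shift^[v.length] (appendWord v x) = x := by
  induction v using List.reverseRecOn with
  | nil => rfl
  | append_singleton v i ih =>
    rw [appendWord_append_singleton, List.length_append, List.length_singleton,
      Function.iterate_succ_apply, shift_appendLetter, ih]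

end Words

/-! ### Restrictions, and the shift on asymptotic classes -/

section Actions

variable {G : Type v} {X : Type u} [Group G] [MulAction G (List X)]

theorem IsRestriction.mul {g₁ g₂ h₁ h₂ : G} {a : List X} (H₁ : IsRestriction g₁ (g₂ • a) h₁)
    (H₂ : IsRestriction g₂ a h₂) : IsRestriction (g₁ * g₂) a (h₁ * h₂) := fun b => by
  rw [mul_smul, H₂ b, H₁, mul_smul, mul_smul]

theorem IsRestriction.inv {g h : G} {a : List X} (H : IsRestriction g (g⁻¹ • a) h) :
    IsRestriction g⁻¹ a h⁻¹ := fun b => by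
  rw [inv_smul_eq_iff, H, smul_inv_smul, smul_inv_smul]

theorem length_smul (hnil : ∀ g : G, g • ([] : List X) = [])
    (hstate : ∀ (g : G) (x : X), ∃ (h : G) (y : X), ∀ a : List X, g • (x :: a) = y :: (h • a))
    (g : G) (a : List X) : (g • a).length = a.length := by
  induction a generalizing g with
  | nil => rw [hnil]
  | cons x a ih =>
    obtain ⟨h, y, H⟩ := hstate g x
    rw [H, List.length_cons, List.length_cons, ih]

theorem exists_isRestriction (hnil : ∀ g : G, g • ([] : List X) = [])
    (hstate : ∀ (g : G) (x : X), ∃ (h : G) (y : X), ∀ a : List X, g • (x :: a) = y :: (h • a))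
    (g : G) (a : List X) : ∃ h : G, IsRestriction g a h := by
  induction a generalizing g with
  | nil => exact ⟨g, fun b => by simp [hnil]⟩
  | cons x a ih =>
    obtain ⟨h, y, H⟩ := hstate g x
    obtain ⟨h', H'⟩ := ih h
    exact ⟨h', fun b => by rw [List.cons_append, H, H, H', List.cons_append]⟩

theorem exists_smul_append_singleton (hnil : ∀ g : G, g • ([] : List X) = [])
    (hstate : ∀ (g : G) (x : X), ∃ (h : G) (y : X), ∀ a : List X, g • (x :: a) = y :: (h • a))
    (g : G) (a : List X) (x : X) : ∃ y : X, g • (a ++ [x]) = g • a ++ [y] := by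
  obtain ⟨h, H⟩ := exists_isRestriction hnil hstate g a
  obtain ⟨h', y, H'⟩ := hstate h x
  exact ⟨y, by rw [H, H', hnil]⟩

theorem adj_smul (hnil : ∀ g : G, g • ([] : List X) = [])
    (hstate : ∀ (g : G) (x : X), ∃ (h : G) (y : X), ∀ a : List X, g • (x :: a) = y :: (h • a))
    (g : G) {a b : List X} (hab : (wordTree X).Adj a b) : (wordTree X).Adj (g • a) (g • b) := by
  rw [wordTree, SimpleGraph.fromRel_adj] at hab ⊢
  refine ⟨fun h => hab.1 (smul_left_cancel g h), ?_⟩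
  rcases hab.2 with ⟨x, rfl⟩ | ⟨x, rfl⟩
  · exact .inl (exists_smul_append_singleton hnil hstate g a x)
  · exact .inr (exists_smul_append_singleton hnil hstate g b x)

/-- The last letter is the deepest one, so the same automorphisms, reindexed by one, match the
shortened words. -/
theorem AsymptoticallyEquivalent.shift (hG : IsSelfSimilarAction G X) {x y : ℕ → X}
    (h : AsymptoticallyEquivalent G x y) :
    AsymptoticallyEquivalent G (shift x) (SelfSimilar.shift y) := by
  obtain ⟨g, hg, hxy⟩ := h
  refine ⟨fun k => g (k + 1), hg.subset (by rintro _ ⟨k, rfl⟩; exact ⟨_, rfl⟩), fun k _ => ?_⟩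
  have h1 := hxy (k + 1) (by omega)
  obtain ⟨z, hz⟩ := exists_smul_append_singleton hG.smul_nil hG.stateClosed (g (k + 1))
    (trunc (SelfSimilar.shift x) k) (x 0)
  rw [trunc_succ_eq_append, trunc_succ_eq_append, hz] at h1
  exact (List.append_inj' h1 rfl).1

end Actions

namespace SelfSimilarStructure

/-! ### The group generated by the twists `g_c` -/

section General

variable {X : Type u} {K : Type v} [TopologicalSpace X] [TopologicalSpace K]
  (L : SelfSimilarStructure X K)

theorem F_π (i : X) (x : ℕ → X) : L.F i (L.π x) = L.π (appendLetter i x) :=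
  congrFun (L.F_comp_π i) x

/-- The map `F_v`, where the leftmost letter of `v` is applied first. -/
def wordMap (v : List X) (c : K) : K := v.foldl (fun d i => L.F i d) c

theorem wordMap_π (v : List X) (x : ℕ → X) : L.wordMap v (L.π x) = L.π (appendWord v x) := by
  induction v generalizing x with
  | nil => rfl
  | cons i v ih =>
    change L.wordMap v (L.F i (L.π x)) = _
    rw [F_π, ih]; rfl

theorem wordMap_trunc (x : ℕ → X) (k : ℕ) :
    L.wordMap (trunc x k) (L.π (shift^[k] x)) = L.π x := by
  rw [wordMap_π, appendWord_trunc]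

/-- The families of permutations `τ_c` of the alphabet with `F_{τ_c(i)}(c) = F_i(c)`. -/
def permGroup : Subgroup (K → Equiv.Perm X) where
  carrier := {τ | ∀ c i, L.F (τ c i) c = L.F i c}
  mul_mem' {σ τ} hσ hτ c i := by
    rw [Pi.mul_apply, Equiv.Perm.mul_apply, hσ, hτ]
  one_mem' _ _ := rfl
  inv_mem' {τ} hτ c i := by
    rw [← hτ c, Pi.inv_apply]; exact congrArg (L.F · c) ((τ c).apply_symm_apply i)

/-- The transformation `g_c` of words with `g_c(i w) = τ_c(i) g_{F_i(c)}(w)`. -/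
def twistFun (τ : K → Equiv.Perm X) : K → List X → List X
  | _, [] => []
  | c, i :: w => τ c i :: twistFun τ (L.F i c) w

theorem twistFun_one (c : K) (w : List X) : L.twistFun 1 c w = w := by
  induction w generalizing c with
  | nil => rfl
  | cons i w ih => rw [twistFun, ih]; rfl

/-- Since `τ` does not change `F_i(c)`, both factors follow the same orbit of points down the tree.
-/
theorem twistFun_mul (σ : K → Equiv.Perm X) {τ : K → Equiv.Perm X} (hτ : τ ∈ L.permGroup)
    (c : K) (w : List X) : L.twistFun (σ * τ) c w = L.twistFun σ c (L.twistFun τ c w) := by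
  induction w generalizing c with
  | nil => rfl
  | cons i w ih => rw [twistFun, twistFun, twistFun, hτ c i, ih]; rfl

/-- The homomorphism sending a family `τ` to the automorphism `g_c` of the tree of words. -/
def twist (c : K) : L.permGroup →* Equiv.Perm (List X) where
  toFun τ :=
    { toFun := L.twistFun τ c
      invFun := L.twistFun (τ⁻¹ : L.permGroup) c
      left_inv := fun w => by
        rw [← twistFun_mul _ _ τ.2, ← Subgroup.coe_mul, inv_mul_cancel]; exact L.twistFun_one c w
      right_inv := fun w => by
        rw [← twistFun_mul _ _ (τ⁻¹).2, ← Subgroup.coe_mul, mul_inv_cancel]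
        exact L.twistFun_one c w }
  map_one' := Equiv.ext (L.twistFun_one c)
  map_mul' σ τ := Equiv.ext (L.twistFun_mul σ τ.2 c)

theorem twist_cons (c : K) (τ : L.permGroup) (i : X) (w : List X) :
    L.twist c τ (i :: w) = τ.1 c i :: L.twist (L.F i c) τ w := rfl

theorem twist_append (c : K) (τ : L.permGroup) (v w : List X) :
    L.twist c τ (v ++ w) = L.twist c τ v ++ L.twist (L.wordMap v c) τ w := by
  induction v generalizing c with
  | nil => rfl
  | cons i v ih => rw [List.cons_append, twist_cons, ih]; rfl

/-- Hence the cells of `v` and `g_c(v)` share a point, which is why twists displace small cells only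
slightly. -/
theorem wordMap_twist (c : K) (τ : L.permGroup) (v : List X) :
    L.wordMap (L.twist c τ v) c = L.wordMap v c := by
  induction v generalizing c with
  | nil => rfl
  | cons i v ih =>
    change L.wordMap (L.twist (L.F i c) τ v) (L.F (τ.1 c i) c) = L.wordMap v (L.F i c)
    rw [τ.2 c i, ih]

/-- The group of tree automorphisms generated by all the `g_c`. -/
def twistGroup : Subgroup (Equiv.Perm (List X)) :=
  Subgroup.closure {g | ∃ c τ, L.twist c τ = g}

theorem twist_mem (c : K) (τ : L.permGroup) : L.twist c τ ∈ L.twistGroup :=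
  Subgroup.subset_closure ⟨c, τ, rfl⟩

theorem apply_nil_of_mem_twistGroup {g : Equiv.Perm (List X)} (hg : g ∈ L.twistGroup) :
    g [] = [] := by
  induction hg using Subgroup.closure_induction with
  | mem g hg => obtain ⟨c, τ, rfl⟩ := hg; rfl
  | one => rfl
  | mul g h _ _ ihg ihh => rw [Equiv.Perm.mul_apply, ihh, ihg]
  | inv g _ ih => rw [Equiv.Perm.inv_eq_iff_eq, ih]

/-- Asking for a permutation of first letters, not just a letter for each `x`, lets the induction
pass to inverses. -/
theorem exists_apply_cons_of_mem_twistGroup {g : Equiv.Perm (List X)} (hg : g ∈ L.twistGroup) :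
    ∃ σ : Equiv.Perm X, ∀ x : X, ∃ h ∈ L.twistGroup, ∀ a : List X, g (x :: a) = σ x :: h a := by
  induction hg using Subgroup.closure_induction with
  | mem g hg =>
    obtain ⟨c, τ, rfl⟩ := hg
    exact ⟨τ.1 c, fun x => ⟨_, L.twist_mem (L.F x c) τ, fun _ => rfl⟩⟩
  | one => exact ⟨1, fun x => ⟨1, one_mem _, fun _ => rfl⟩⟩
  | mul g h _ _ ihg ihh =>
    obtain ⟨σ, hσ⟩ := ihg
    obtain ⟨ρ, hρ⟩ := ihh
    refine ⟨σ * ρ, fun x => ?_⟩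
    obtain ⟨h', hh', H'⟩ := hρ x
    obtain ⟨g', hg', H⟩ := hσ (ρ x)
    exact ⟨g' * h', mul_mem hg' hh', fun a => by
      rw [Equiv.Perm.mul_apply, H', H]; rfl⟩
  | inv g _ ih =>
    obtain ⟨σ, hσ⟩ := ih
    refine ⟨σ⁻¹, fun x => ?_⟩
    obtain ⟨h, hh, H⟩ := hσ (σ⁻¹ x)
    exact ⟨h⁻¹, inv_mem hh, fun a => by
      rw [Equiv.Perm.inv_eq_iff_eq, H]
      exact congrArg₂ _ (σ.apply_symm_apply x).symm (h.apply_symm_apply a).symm⟩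

theorem isSelfSimilarAction_twistGroup : IsSelfSimilarAction L.twistGroup X := by
  have hnil : ∀ g : L.twistGroup, g • ([] : List X) = [] := fun g =>
    L.apply_nil_of_mem_twistGroup g.2
  have hstate : ∀ (g : L.twistGroup) (x : X), ∃ (h : L.twistGroup) (y : X), ∀ a : List X,
      g • (x :: a) = y :: (h • a) := fun g x => by
    obtain ⟨σ, hσ⟩ := L.exists_apply_cons_of_mem_twistGroup g.2
    obtain ⟨h, hh, H⟩ := hσ x
    exact ⟨⟨h, hh⟩, σ x, H⟩
  refine ⟨hnil, fun g a b => ⟨fun h => ?_, adj_smul hnil hstate g⟩, fun g h H => ?_, hstate⟩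
  · simpa using adj_smul hnil hstate g⁻¹ h
  · exact Subtype.ext (Equiv.ext H)

/-- The image of the post-critical set in `K`. -/
def postCriticalPoints : Set K := L.π '' L.postCriticalSet

theorem mem_criticalSet_of_F_eq {c : K} {x : ℕ → X} {i j : X} (hij : i ≠ j)
    (h : L.F i c = L.F j c) (hx : L.π x = L.F i c) : x ∈ L.criticalSet := by
  simp only [criticalSet, Set.mem_preimage, Set.mem_iUnion]
  exact ⟨i, j, hij, ⟨c, hx.symm⟩, ⟨c, (hx.trans h).symm⟩⟩

theorem shift_iterate_mem_postCriticalSet {x : ℕ → X} (hx : x ∈ L.criticalSet) {n : ℕ}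
    (hn : 1 ≤ n) : shift^[n] x ∈ L.postCriticalSet := by
  simp only [postCriticalSet, Set.mem_iUnion]
  exact ⟨n, hn, x, hx, rfl⟩

theorem shift_mem_postCriticalSet {x : ℕ → X} (hx : x ∈ L.postCriticalSet) :
    shift x ∈ L.postCriticalSet := by
  simp only [postCriticalSet, Set.mem_iUnion] at hx ⊢
  obtain ⟨n, hn, y, hy, rfl⟩ := hx
  exact ⟨n + 1, by omega, y, hy, Function.iterate_succ_apply' _ _ _⟩

theorem eq_of_F_eq {c : K} (hc : c ∉ L.postCriticalPoints) {i j : X} (h : L.F i c = L.F j c) :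
    i = j := by
  by_contra hij
  obtain ⟨x, rfl⟩ := L.surjective_π c
  exact hc ⟨x, L.shift_iterate_mem_postCriticalSet (x := appendLetter i x) (n := 1)
    (L.mem_criticalSet_of_F_eq hij h (L.F_π i x).symm) le_rfl, rfl⟩

theorem permGroup_apply_eq_one (τ : L.permGroup) {c : K} (hc : c ∉ L.postCriticalPoints) :
    τ.1 c = 1 := Equiv.ext fun i => L.eq_of_F_eq hc (τ.2 c i)

/-- A family is determined by its values on the finitely many post-critical points. -/
theorem finite_permGroup [Finite X] (hL : L.IsPCF) : Finite L.permGroup := by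
  have : Finite L.postCriticalPoints := (hL.image _).to_subtype
  refine Finite.of_injective
    (fun (τ : L.permGroup) (c : L.postCriticalPoints) => τ.1 c) fun σ τ h => ?_
  refine Subtype.ext (funext fun c => ?_)
  by_cases hc : c ∈ L.postCriticalPoints
  · exact congrFun h ⟨c, hc⟩
  · rw [L.permGroup_apply_eq_one σ hc, L.permGroup_apply_eq_one τ hc]

/-! ### Consequences of a well-defined shift -/

section ShiftMap

variable {s : K → K} (hs : s ∘ L.π = L.π ∘ shift)
include hs

theorem shiftMap_iterate_π (n : ℕ) (x : ℕ → X) : s^[n] (L.π x) = L.π (shift^[n] x) := by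
  induction n generalizing x with
  | zero => rfl
  | succ n ih =>
    rw [Function.iterate_succ_apply, Function.iterate_succ_apply, ← ih]
    exact congrArg _ (congrFun hs x)

theorem shiftMap_F (i : X) (c : K) : s (L.F i c) = c := by
  obtain ⟨x, rfl⟩ := L.surjective_π c
  rw [F_π]
  exact congrFun hs _

theorem F_mem_postCriticalPoints {c : K} {i : X} (h : L.F i c ∈ L.postCriticalPoints) :
    c ∈ L.postCriticalPoints := by
  obtain ⟨x, hx, h⟩ := h
  refine ⟨shift x, L.shift_mem_postCriticalSet hx, ?_⟩
  rw [← L.shiftMap_F hs i c, ← h]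
  exact (congrFun hs x).symm

theorem twist_eq_one (τ : L.permGroup) {c : K} (hc : c ∉ L.postCriticalPoints) :
    L.twist c τ = 1 := by
  refine Equiv.ext fun w => ?_
  induction w generalizing c with
  | nil => rfl
  | cons i w ih =>
    rw [twist_cons, ih fun h => hc (L.F_mem_postCriticalPoints hs h),
      L.permGroup_apply_eq_one τ hc]
    rfl

theorem finite_range_twist [Finite X] (hL : L.IsPCF) : {g | ∃ c τ, L.twist c τ = g}.Finite := by
  have := L.finite_permGroup hL
  refine (((hL.image L.π).image2 (fun c τ => L.twist c τ)
    (Set.toFinite (Set.univ : Set L.permGroup))).insert 1).subset ?_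
  rintro _ ⟨c, τ, rfl⟩
  by_cases hc : c ∈ L.postCriticalPoints
  · exact .inr ⟨c, hc, τ, trivial, rfl⟩
  · exact .inl (L.twist_eq_one hs τ hc)

/-- If the last letters differed, every address of the point would be critical. Appending the period
`x_m … x_1` maps the fibre injectively into itself, and the fibre is finite by post-critical
finiteness. So this map is onto, and `y` too ends in `x_1`. -/
theorem apply_zero_eq_of_periodic (hL : L.IsPCF) {x y : ℕ → X} (hxy : L.π x = L.π y) {m : ℕ}
    (hm : 1 ≤ m) (hper : s^[m] (L.π x) = L.π x) : x 0 = y 0 := by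
  by_contra hne
  have hx0 : L.F (x 0) (s (L.π x)) = L.π x := by
    rw [show s (L.π x) = L.π (shift x) from congrFun hs x, F_π, appendLetter_shift]
  have hy0 : L.F (y 0) (s (L.π x)) = L.π x := by
    rw [hxy, show s (L.π y) = L.π (shift y) from congrFun hs y, F_π, appendLetter_shift]
  have hcrit : ∀ z, L.π z = L.π x → z ∈ L.criticalSet := fun z hz =>
    L.mem_criticalSet_of_F_eq hne (hx0.trans hy0.symm) (hz.trans hx0.symm)
  have hmaps : Set.MapsTo (appendWord (trunc x m)) {z | L.π z = L.π x} {z | L.π z = L.π x} := by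
    intro z (hz : L.π z = L.π x)
    change L.π _ = _
    rw [← wordMap_π, hz, ← hper, L.shiftMap_iterate_π hs, wordMap_trunc,
      ← L.shiftMap_iterate_π hs, hper]
  have hshift : ∀ z, shift^[m] (appendWord (trunc x m) z) = z := fun z => by
    simpa only [length_trunc] using shift_iterate_appendWord (trunc x m) z
  -- Each `z` in the fibre is the `m`-th shift of another fibre element, which is critical.
  have hfin : {z | L.π z = L.π x}.Finite := hL.subset fun z hz => by
    rw [← hshift z]
    exact L.shift_iterate_mem_postCriticalSet (hcrit _ (hmaps hz)) hm
  have hinj : Function.Injective (appendWord (trunc x m)) := Function.LeftInverse.injective hshift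
  obtain ⟨z, -, hz⟩ := Set.surj_on_of_inj_on_of_ncard_le
    (fun z (_ : z ∈ {z | L.π z = L.π x}) => appendWord (trunc x m) z) (fun z hz => hmaps hz)
    (fun _ _ _ _ h => hinj h) le_rfl hfin y hxy.symm
  refine hne ?_
  rw [hz]
  obtain ⟨m, rfl⟩ : ∃ n, m = n + 1 := ⟨m - 1, by omega⟩
  rw [trunc_succ_eq_append, appendWord_append_singleton]
  rfl

/-- The orbit may visit `c` repeatedly, but only the first visit can have `x k ≠ y k`: on a later
one `s^[k] (π x)` is periodic. One transposition at each `c` therefore suffices. -/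
theorem exists_permGroup_apply_eq (hL : L.IsPCF) {x y : ℕ → X} (hxy : L.π x = L.π y) :
    ∃ τ : L.permGroup, ∀ k, τ.1 (s^[k + 1] (L.π x)) (x k) = y k := by
  classical
  have hk : ∀ k, L.π (shift^[k] x) = L.π (shift^[k] y) := fun k => by
    rw [← L.shiftMap_iterate_π hs, ← L.shiftMap_iterate_π hs, hxy]
  have hFx : ∀ z, L.π z = L.π x → ∀ k, L.F (z k) (s^[k + 1] (L.π x)) = s^[k] (L.π x) := by
    intro z hz k
    rw [← hz, L.shiftMap_iterate_π hs, L.shiftMap_iterate_π hs, F_π,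
      ← appendLetter_shift (shift^[k] z), Function.iterate_succ_apply', shift_iterate_apply,
      zero_add]
  have hper : ∀ k m, 1 ≤ m → s^[m] (s^[k] (L.π x)) = s^[k] (L.π x) → x k = y k := by
    intro k m hm h
    rw [L.shiftMap_iterate_π hs k] at h
    simpa only [shift_iterate_apply, zero_add] using
      L.apply_zero_eq_of_periodic hs hL (hk k) hm h
  have hlt : ∀ k l, k < l → s^[k + 1] (L.π x) = s^[l + 1] (L.π x) → x l = y l := by
    intro k l hkl h
    refine hper l (l - k) (by omega) ?_
    rw [← Function.iterate_add_apply, show l - k + l = (l - k - 1) + (l + 1) by omega,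
      Function.iterate_add_apply, ← h, ← Function.iterate_add_apply]
    congr 2; omega
  have key : ∀ c, ∃ ρ : Equiv.Perm X, (∀ i, L.F (ρ i) c = L.F i c) ∧
      ∀ k, s^[k + 1] (L.π x) = c → ρ (x k) = y k := by
    intro c
    by_cases h : ∃ l, s^[l + 1] (L.π x) = c ∧ x l ≠ y l
    · obtain ⟨l, rfl, hl⟩ := h
      refine ⟨Equiv.swap (x l) (y l), fun i => ?_, fun k hkl => ?_⟩
      · rcases em (i = x l) with rfl | hix
        · rw [Equiv.swap_apply_left, hFx x rfl, hFx y hxy.symm]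
        · by_cases hiy : i = y l
          · rw [hiy, Equiv.swap_apply_right, hFx x rfl, hFx y hxy.symm]
          · rw [Equiv.swap_apply_of_ne_of_ne hix hiy]
      · rcases lt_trichotomy k l with h | rfl | h
        · exact absurd (hlt k l h hkl) hl
        · exact Equiv.swap_apply_left _ _
        · have hxk := hlt l k h hkl.symm
          -- Otherwise `s^[l] (π x)` would be periodic, contradicting `hl`. So `x k` leads from `c`
          -- to a different point than `x l` and `y l` do, and the swap fixes it.
          have hne : s^[k] (L.π x) ≠ s^[l] (L.π x) := fun he => by
            refine hl (hper l (k - l) (by omega) ?_)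
            rw [← Function.iterate_add_apply, ← he]
            congr 2; omega
          rw [← hxk, Equiv.swap_apply_of_ne_of_ne]
          · intro he
            apply hne
            rw [← hFx x rfl k, ← hFx x rfl l, he, hkl]
          · intro he
            apply hne
            rw [← hFx x rfl k, ← hFx y hxy.symm l, he, hkl]
    · push Not at h
      exact ⟨1, fun _ => rfl, h⟩
  choose ρ hρ hρ' using key
  exact ⟨⟨ρ, hρ⟩, fun k => hρ' _ k rfl⟩

theorem asymptoticallyEquivalent_of_π_eq [Finite X] (hL : L.IsPCF) {x y : ℕ → X}
    (hxy : L.π x = L.π y) : AsymptoticallyEquivalent L.twistGroup x y := by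
  obtain ⟨τ, hτ⟩ := L.exists_permGroup_apply_eq hs hL hxy
  refine ⟨fun k => ⟨_, L.twist_mem (s^[k] (L.π x)) τ⟩, ?_, fun k _ => ?_⟩
  · refine Set.Finite.of_finite_image ?_ Subtype.val_injective.injOn
    refine (L.finite_range_twist hs hL).subset ?_
    rintro _ ⟨_, ⟨k, rfl⟩, rfl⟩
    exact ⟨_, τ, rfl⟩
  · change L.twist (s^[k] (L.π x)) τ (trunc x k) = trunc y k
    induction k with
    | zero => rfl
    | succ k ih =>
      have : L.F (x k) (s^[k + 1] (L.π x)) = s^[k] (L.π x) := by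
        rw [L.shiftMap_iterate_π hs, L.shiftMap_iterate_π hs, F_π,
          ← appendLetter_shift (shift^[k] x), Function.iterate_succ_apply', shift_iterate_apply,
          zero_add]
      rw [trunc, twist_cons, hτ, this]
      rcases k.eq_zero_or_pos with rfl | hk
      · rfl
      · rw [ih hk, trunc]

end ShiftMap

end General

/-! ### Contraction and the asymptotic relation -/

section Metric

variable {X : Type u} {K : Type v} [TopologicalSpace X] [MetricSpace K]
  (L : SelfSimilarStructure X K)

theorem exists_dist_π_lt [Finite X] [DiscreteTopology X] {ε : ℝ} (hε : 0 < ε) :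
    ∃ k, ∀ x y : ℕ → X, (∀ n < k, x n = y n) → dist (L.π x) (L.π y) < ε := by
  let _ : MetricSpace (ℕ → X) := PiNat.metricSpace
  obtain ⟨δ, hδ, h⟩ := Metric.uniformContinuous_iff.1
    (CompactSpace.uniformContinuous_of_continuous L.continuous_π) ε hε
  obtain ⟨k, hk⟩ := exists_pow_lt_of_lt_one hδ (show (1 / 2 : ℝ) < 1 by norm_num)
  refine ⟨k, fun x y hxy => h (lt_of_le_of_lt ?_ hk)⟩
  exact PiNat.mem_cylinder_iff_dist_le.1 (PiNat.mem_cylinder_iff.2 hxy)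

theorem exists_dist_wordMap_lt [Finite X] [DiscreteTopology X] {ε : ℝ} (hε : 0 < ε) :
    ∃ k, ∀ v : List X, k ≤ v.length → ∀ c d, dist (L.wordMap v c) (L.wordMap v d) < ε := by
  obtain ⟨k, hk⟩ := L.exists_dist_π_lt hε
  refine ⟨k, fun v hv c d => ?_⟩
  obtain ⟨x, rfl⟩ := L.surjective_π c
  obtain ⟨y, rfl⟩ := L.surjective_π d
  rw [wordMap_π, wordMap_π]
  exact hk _ _ fun n hn => appendWord_apply_eq v x y (hn.trans_le hv)

/-- The element `g` displaces the cell of every long word by less than `ε`, and its restriction to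
such a word is trivial or some `g_a` with `a` a post-critical point close to the cell. -/
def IsCloseAt (g : Equiv.Perm (List X)) (ε : ℝ) (v : List X) : Prop :=
  (∀ c, dist (L.wordMap (g v) c) (L.wordMap v c) < ε) ∧
    ∃ h, IsRestriction g v h ∧ (h = 1 ∨ ∃ a ∈ L.postCriticalPoints, ∃ τ, h = L.twist a τ ∧
      ∀ c, dist a (L.wordMap v c) < ε)

theorem exists_isCloseAt [Finite X] [DiscreteTopology X] {s : K → K}
    (hs : s ∘ L.π = L.π ∘ shift) (hL : L.IsPCF) {g : Equiv.Perm (List X)}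
    (hg : g ∈ L.twistGroup) {ε : ℝ} (hε : 0 < ε) :
    ∃ k, ∀ v : List X, k ≤ v.length → L.IsCloseAt g ε v := by
  have hlen : ∀ g ∈ L.twistGroup, ∀ v : List X, (g v).length = v.length := fun g hg v =>
    length_smul L.isSelfSimilarAction_twistGroup.smul_nil
      L.isSelfSimilarAction_twistGroup.stateClosed (⟨g, hg⟩ : L.twistGroup) v
  obtain ⟨δ, hδ, hsep⟩ : ∃ δ : ℝ, 0 < δ ∧ ∀ a ∈ L.postCriticalPoints,
      ∀ b ∈ L.postCriticalPoints, a ≠ b → δ ≤ dist a b := by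
    obtain ⟨δ, hδ, hsep⟩ := (hL.image L.π).relatively_discrete
    obtain ⟨r, hr, hrδ⟩ := ENNReal.lt_iff_exists_nnreal_btwn.1 hδ
    refine ⟨r, by simpa using hr, fun a ha b hb hab => ?_⟩
    have h := hrδ.le.trans (hsep a ha b hb hab)
    rw [edist_nndist, ENNReal.coe_le_coe] at h
    exact h
  induction hg using Subgroup.closure_induction generalizing ε with
  | mem g hg =>
    obtain ⟨c, τ, rfl⟩ := hg
    obtain ⟨k, hk⟩ := L.exists_dist_wordMap_lt (half_pos hε)
    refine ⟨k, fun v hv => ⟨fun d => ?_, _, L.twist_append c τ v, ?_⟩⟩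
    · refine (dist_triangle _ (L.wordMap v c) _).trans_lt ?_
      have h1 := hk v hv c d
      have h2 := hk (L.twist c τ v) (by rwa [hlen _ (L.twist_mem c τ)]) d c
      rw [wordMap_twist] at h2
      linarith
    · by_cases hc : L.wordMap v c ∈ L.postCriticalPoints
      · exact .inr ⟨_, hc, τ, rfl, fun d => (hk v hv c d).trans (half_lt_self hε)⟩
      · exact .inl (L.twist_eq_one hs τ hc)
  | one => exact ⟨0, fun v _ => ⟨fun c => by simpa using hε, 1, fun b => rfl, .inl rfl⟩⟩
  | mul g₁ g₂ _ hg₂ ih₁ ih₂ =>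
    -- `ε / 2` bounds the total displacement by `ε`. With `δ / 3`, `a` is within `2δ/3` of the cell
    -- of `v` and `b` within `δ/3`, which forces `a = b`.
    obtain ⟨k₁, hk₁⟩ := ih₁ (ε := min (ε / 2) (δ / 3)) (by positivity)
    obtain ⟨k₂, hk₂⟩ := ih₂ (ε := min (ε / 2) (δ / 3)) (by positivity)
    refine ⟨max k₁ k₂, fun v hv => ?_⟩
    have hv₂ : k₁ ≤ (g₂ v).length := by
      rw [hlen g₂ hg₂]; exact (le_max_left _ _).trans hv
    obtain ⟨hd₁, h₁, hr₁, hc₁⟩ := hk₁ (g₂ v) hv₂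
    obtain ⟨hd₂, h₂, hr₂, hc₂⟩ := hk₂ v ((le_max_right _ _).trans hv)
    simp only [lt_min_iff] at hd₁ hd₂ hc₁ hc₂
    refine ⟨fun c => ?_, h₁ * h₂, hr₁.mul hr₂, ?_⟩
    · rw [Equiv.Perm.mul_apply]
      linarith [dist_triangle (L.wordMap (g₁ (g₂ v)) c) (L.wordMap (g₂ v) c) (L.wordMap v c),
        (hd₁ c).1, (hd₂ c).1]
    · rcases hc₁ with rfl | ⟨a, ha, σ, rfl, hca⟩
      · rcases hc₂ with rfl | ⟨b, hb, τ, rfl, hcb⟩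
        · exact .inl (one_mul 1)
        · exact .inr ⟨b, hb, τ, one_mul _, fun c => by linarith [(hcb c).1]⟩
      · have hca' : ∀ c, dist a (L.wordMap v c) < ε ∧ dist a (L.wordMap v c) < 2 * (δ / 3) := by
          intro c
          have := dist_triangle a (L.wordMap (g₂ v) c) (L.wordMap v c)
          constructor <;> linarith [hca c, hd₂ c, (hca c).1, (hca c).2, (hd₂ c).1, (hd₂ c).2]
        rcases hc₂ with rfl | ⟨b, hb, τ, rfl, hcb⟩
        · exact .inr ⟨a, ha, σ, mul_one _, fun c => (hca' c).1⟩
        · obtain rfl : a = b := by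
            by_contra hab
            have h1 := hsep a ha b hb hab
            have h2 := dist_triangle_right a b (L.wordMap v a)
            linarith [(hca' a).2, (hcb a).2]
          exact .inr ⟨a, ha, σ * τ, (map_mul _ _ _).symm, fun c => (hca' c).1⟩
  | inv g hg ih =>
    obtain ⟨k, hk⟩ := ih (half_pos hε)
    refine ⟨k, fun v hv => ?_⟩
    have hv' : k ≤ (g⁻¹ v).length := by rwa [hlen _ (inv_mem hg)]
    obtain ⟨hd, h, hr, hc⟩ := hk _ hv'
    have hgv : g (g⁻¹ v) = v := g.apply_symm_apply v
    rw [hgv] at hd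
    refine ⟨fun c => by rw [dist_comm]; exact (hd c).trans (half_lt_self hε), h⁻¹, IsRestriction.inv hr, ?_⟩
    rcases hc with rfl | ⟨a, ha, τ, rfl, hca⟩
    · exact .inl inv_one
    · refine .inr ⟨a, ha, τ⁻¹, (map_inv _ _).symm, fun c => ?_⟩
      linarith [dist_triangle_right a (L.wordMap v c) (L.wordMap (g⁻¹ v) c), hd c, hca c]

theorem isContractingAction_twistGroup [Finite X] [DiscreteTopology X] {s : K → K}
    (hs : s ∘ L.π = L.π ∘ shift) (hL : L.IsPCF) : IsContractingAction L.twistGroup X := by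
  refine ⟨L.isSelfSimilarAction_twistGroup,
    Subtype.val ⁻¹' insert 1 {g | ∃ c τ, L.twist c τ = g},
    ((L.finite_range_twist hs hL).insert 1).preimage Subtype.val_injective.injOn, fun g => ?_⟩
  obtain ⟨k, hk⟩ := L.exists_isCloseAt hs hL g.2 one_pos
  refine ⟨k, fun v hv => ?_⟩
  obtain ⟨-, h, hr, rfl | ⟨a, -, τ, rfl, -⟩⟩ := hk v hv
  · exact ⟨1, .inl rfl, hr⟩
  · exact ⟨⟨_, L.twist_mem a τ⟩, .inr ⟨a, τ, rfl⟩, hr⟩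

/-- Finitely many group elements share one length beyond which they displace cells by less than `ε /
2`; the cells around `π x` and `π y` are then close. -/
theorem π_eq_of_asymptoticallyEquivalent [Finite X] [DiscreteTopology X] {s : K → K}
    (hs : s ∘ L.π = L.π ∘ shift) (hL : L.IsPCF) {x y : ℕ → X}
    (hxy : AsymptoticallyEquivalent L.twistGroup x y) : L.π x = L.π y := by
  obtain ⟨g, hg, hxy⟩ := hxy
  refine eq_of_forall_dist_le fun ε hε => ?_
  have hclose : ∀ h : L.twistGroup, ∃ k, ∀ v : List X, k ≤ v.length →
      L.IsCloseAt h (ε / 2) v := fun h => L.exists_isCloseAt hs hL h.2 (half_pos hε)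
  choose N hN using hclose
  obtain ⟨M, hM⟩ := L.exists_dist_wordMap_lt (half_pos hε)
  obtain ⟨B, hB⟩ := (hg.image N).bddAbove
  let k := max (max B M) 1
  have h₁ := (hN (g k) (trunc x k) (by
    rw [length_trunc]
    exact (hB ⟨g k, ⟨k, rfl⟩, rfl⟩).trans ((le_max_left _ _).trans (le_max_left _ _)))).1
      (L.π (shift^[k] x))
  have h₂ := hM (trunc y k) (by
    rw [length_trunc]; exact (le_max_right _ _).trans (le_max_left _ _))
      (L.π (shift^[k] x)) (L.π (shift^[k] y))
  rw [show (g k : Equiv.Perm (List X)) (trunc x k) = trunc y k from hxy k (le_max_right _ _),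
    wordMap_trunc, dist_comm] at h₁
  rw [wordMap_trunc] at h₂
  linarith [dist_triangle (L.π x) (L.wordMap (trunc y k) (L.π (shift^[k] x))) (L.π y)]

theorem asymptoticallyEquivalent_twistGroup_iff [Finite X] [DiscreteTopology X] {s : K → K}
    (hs : s ∘ L.π = L.π ∘ shift) (hL : L.IsPCF) {x y : ℕ → X} :
    AsymptoticallyEquivalent L.twistGroup x y ↔ L.π x = L.π y :=
  ⟨L.π_eq_of_asymptoticallyEquivalent hs hL, L.asymptoticallyEquivalent_of_π_eq hs hL⟩

end Metric

/-! ### Identification with the limit space -/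

section LimitSpace

variable {X : Type u} {K : Type v} [TopologicalSpace X] [TopologicalSpace K]
  (L : SelfSimilarStructure X K)

theorem exists_homeomorph_limitSpace [Finite X] {G : Type w} [Group G] [MulAction G (List X)]
    (h : ∀ x y, AsymptoticallyEquivalent G x y ↔ L.π x = L.π y) :
    ∃ e : LimitSpace G X ≃ₜ K, ∀ x, e (limitMap G X x) = L.π x := by
  have := L.metrizableSpace
  have hq : Topology.IsQuotientMap (⟨L.π, L.continuous_π⟩ : C(ℕ → X, K)) :=
    L.continuous_π.isClosedMap.isQuotientMap L.continuous_π L.surjective_π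
  have heq : asymptoticSetoid G X = Setoid.ker (⟨L.π, L.continuous_π⟩ : C(ℕ → X, K)) :=
    Setoid.ext h
  -- Generalising the setoid allows its equality with the kernel to be substituted.
  suffices H : ∀ S : Setoid (ℕ → X), S = Setoid.ker (⟨L.π, L.continuous_π⟩ : C(ℕ → X, K)) →
      ∃ e : Quotient S ≃ₜ K, ∀ x, e (Quotient.mk S x) = L.π x from H _ heq
  rintro _ rfl
  exact ⟨hq.homeomorph, fun _ => rfl⟩

/-- The self-similar structure transported along a homeomorphism. -/
def transport {K' : Type w} [TopologicalSpace K'] (e : K' ≃ₜ K) : SelfSimilarStructure X K' where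
  compactSpace := have := L.compactSpace; e.symm.compactSpace
  metrizableSpace := have := L.metrizableSpace; e.isEmbedding.metrizableSpace
  F i := e.symm ∘ L.F i ∘ e
  continuous_F i := e.symm.continuous.comp ((L.continuous_F i).comp e.continuous)
  injective_F i := e.symm.injective.comp ((L.injective_F i).comp e.injective)
  π := e.symm ∘ L.π
  continuous_π := e.symm.continuous.comp L.continuous_π
  surjective_π := e.symm.surjective.comp L.surjective_π
  F_comp_π i := funext fun x => by simp [F_π]

theorem shiftWellDefined_of_isomorphic_limitSpace {G : Type w} [Group G] [MulAction G (List X)]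
    (hG : IsSelfSimilarAction G X) (L' : SelfSimilarStructure X (LimitSpace G X))
    (hπ : L'.π = limitMap G X) (h : L'.Isomorphic L) : L.ShiftWellDefined := by
  obtain ⟨ρ, e, he⟩ := h
  have key : ∀ x y, L.π x = L.π y → L.π (shift x) = L.π (shift y) := by
    have hρ : ∀ x, L.π x = e (limitMap G X fun n => ρ.symm (x n)) := fun x => by
      rw [← hπ, he]; simp
    intro x y hxy
    rw [hρ, hρ, e.injective.eq_iff] at hxy ⊢
    exact Quotient.sound (AsymptoticallyEquivalent.shift hG (Quotient.exact hxy))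
  refine ⟨fun c => L.π (shift (Function.surjInv L.surjective_π c)), funext fun x => ?_⟩
  exact key _ _ (Function.surjInv_eq L.surjective_π _)

end LimitSpace

end SelfSimilarStructure

end SelfSimilar

theorem mainTheorem3 {X : Type u} [Finite X] [TopologicalSpace X] [DiscreteTopology X]
    {K : Type v} [TopologicalSpace K] (L : SelfSimilar.SelfSimilarStructure X K)
    (hL : L.IsPCF) :
    (∃ (G : Type u) (_ : Group G) (_ : MulAction G (List X)),
      SelfSimilar.IsContractingAction G X ∧
      ∃ L' : SelfSimilar.SelfSimilarStructure X (SelfSimilar.LimitSpace G X),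
        L'.π = SelfSimilar.limitMap G X ∧ L'.Isomorphic L) ↔
    L.ShiftWellDefined := by
  constructor
  · rintro ⟨G, _, _, hG, L', hπ, h⟩
    exact L.shiftWellDefined_of_isomorphic_limitSpace hG.isSelfSimilarAction L' hπ h
  · rintro ⟨s, hs⟩
    have := L.metrizableSpace
    let _ : MetricSpace K := TopologicalSpace.metrizableSpaceMetric K
    obtain ⟨e, he⟩ := L.exists_homeomorph_limitSpace fun x y =>
      L.asymptoticallyEquivalent_twistGroup_iff hs hL (x := x) (y := y)
    have hπ : (L.transport e).π = SelfSimilar.limitMap L.twistGroup X :=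
      funext fun x => (e.symm_apply_eq).2 (he x).symm
    refine ⟨L.twistGroup, inferInstance, inferInstance, L.isContractingAction_twistGroup hs hL,
      L.transport e, hπ, Equiv.refl X, e, fun x => ?_⟩
    rw [hπ, he]
    rfl
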